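/- All graphs are finite and simple. In the domination game on a graph $G$, Dominator and Staller alternately select vertices, Dominator moving first; each selected vertex $v$ must dominate at least one vertex (of its closed neighbourhood $N[v]$) that was not dominated before, and the game ends when all vertices are dominated. Dominator wants the number of moves to be as small as possible, Staller as large as possible; the *game domination number* $\gamma_g(G)$ is the number of moves under optimal play. For an edge $e$, $G-e$ is $G$ with $e$ deleted. Let $Z$ be the graph on $\{0,\dots,8\}$ formed by the cycle $0\,1\,2\,3\,4\,5\,6\,7\,0$, the edges $16$ and $25$, and the edges $83, 84, 85$; put $z=4$. For a graph $H$ with a vertex $z$ and for $k\ge 0$, let $H_k$ be the following graph. Add to $H$ a vertex $z'$ adjacent to $z$ and to all neighbours of $z$ in $H$; take the disjoint union with a star $K_{1,5}$ with centre $x$ and a chosen leaf $x'$; add the edges $zx$ and $e=z'x'$; finally take $k$ copies of the path $P_6$ on six vertices and identify one end of each of them with $x$. Let $X_k=Z_k$ (with $H=Z$, $z=4$), and let $Q_k=(C_6)_k$ (with $H=C_6$ and $z$ any vertex of $C_6$). **Proposition.** 1. For every integer $\ell\ge 5$ there is a connected graph $G$ with an edge $e$ such that $\gamma_g(G)=\ell$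 and $\gamma_g(G-e)=\ell-2$. 2. These values are realized by the families above: for every $k\ge 0$, the graphs $X_k$ and $Q_k$ are connected and, with $e=z'x'$, $$\gamma_g(X_k)=2k+6,\quad \gamma_g(X_k-e)=2k+4,\qquad \gamma_g(Q_k)=2k+5,\quad \gamma_g(Q_k-e)=2k+3 .$$ 3. For $\ell\le 4$ there is no graph $G$, connected or not, with an edge $e$ such that $\gamma_g(G)=\ell$ and $\gamma_g(G-e)=\ell-2$. -/

import Mathlib

namespace DominationGame

/-! ### The domination game -/

section Game

variable {V : Type*} [Fintype V]

open Classical in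
/-- The closed neighbourhood `N[v]`. -/
noncomputable def closedNbhd (G : SimpleGraph V) (v : V) : Finset V :=
  Finset.univ.filter fun w => w = v ∨ G.Adj v w

open Classical in
/-- The vertices that may be selected when exactly the vertices of `D` are dominated: those that
dominate at least one new vertex. -/
noncomputable def legalMoves (G : SimpleGraph V) (D : Finset V) : Finset V :=
  Finset.univ.filter fun v => ¬ closedNbhd G v ⊆ D

open Classical in
/-- The set of dominated vertices after `v` is selected in the position `D`. -/
noncomputable def play (G : SimpleGraph V) (D : Finset V) (v : V) : Finset V :=
  D ∪ closedNbhd G v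

theorem mem_closedNbhd {G : SimpleGraph V} {v w : V} :
    w ∈ closedNbhd G v ↔ w = v ∨ G.Adj v w := by
  simp [closedNbhd]

theorem mem_legalMoves {G : SimpleGraph V} {D : Finset V} {v : V} :
    v ∈ legalMoves G D ↔ ¬ closedNbhd G v ⊆ D := by
  simp [legalMoves]

theorem mem_play {G : SimpleGraph V} {D : Finset V} {v w : V} :
    w ∈ play G D v ↔ w ∈ D ∨ w = v ∨ G.Adj v w := by
  simp [play, mem_closedNbhd]

/-- The game goes on as long as some vertex is undominated. -/
theorem legalMoves_nonempty {G : SimpleGraph V} {D : Finset V} (h : D ≠ Finset.univ) :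
    (legalMoves G D).Nonempty := by
  obtain ⟨v, hv⟩ : ∃ v, v ∉ D := by
    by_contra hc
    push Not at hc
    exact h (Finset.eq_univ_iff_forall.2 hc)
  exact ⟨v, mem_legalMoves.2 fun hs => hv (hs (mem_closedNbhd.2 (Or.inl rfl)))⟩

theorem card_lt_of_mem_legalMoves {G : SimpleGraph V} {D : Finset V} {v : V}
    (hv : v ∈ legalMoves G D) :
    Fintype.card V - (play G D v).card < Fintype.card V - D.card := by
  have hlt : D.card < (play G D v).card := by
    refine Finset.card_lt_card ⟨fun w hw => mem_play.2 (Or.inl hw), fun hs => ?_⟩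
    exact mem_legalMoves.1 hv fun w hw => hs (mem_play.2 (Or.inr (mem_closedNbhd.1 hw)))
  have hle : (play G D v).card ≤ Fintype.card V := Finset.card_le_univ _
  omega

/-- The two players. -/
inductive Player
  | dominator
  | staller

open Classical in
/-- The number of moves that are still made under optimal play when `D` is the set of dominated
vertices and player `p` is to move. Dominator minimizes it, Staller maximizes it. -/
noncomputable def movesLeft (G : SimpleGraph V) (p : Player) (D : Finset V) : ℕ :=
  if h : D = Finset.univ then 0
  else
    match p with
    | .dominator =>
        1 + (legalMoves G D).attach.inf' ((legalMoves_nonempty h).attach)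
          fun v => movesLeft G .staller (play G D v.1)
    | .staller =>
        1 + (legalMoves G D).attach.sup' ((legalMoves_nonempty h).attach)
          fun v => movesLeft G .dominator (play G D v.1)
termination_by Fintype.card V - D.card
decreasing_by
  all_goals exact card_lt_of_mem_legalMoves v.2

/-- The game domination number `γ_g(G)`: Dominator starts and no vertex is dominated. -/
noncomputable def gameDominationNumber (G : SimpleGraph V) : ℕ :=
  movesLeft G .dominator ∅

end Game

/-! ### The graphs `X_k` and `Q_k` -/

/-- The graph `Z`: an 8-cycle `0 1 2 3 4 5 6 7`, the chords `16` and `25`, and a vertex `8`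
adjacent to `3`, `4` and `5`. The distinguished vertex `z` is `4`. -/
def graphZ : SimpleGraph (Fin 9) :=
  SimpleGraph.fromEdgeSet
    {s(0, 1), s(1, 2), s(2, 3), s(3, 4), s(4, 5), s(5, 6), s(6, 7), s(7, 0),
     s(1, 6), s(2, 5), s(8, 3), s(8, 4), s(8, 5)}

/-- The vertices of `attach H z k`, where `H` is a graph on `W`. -/
inductive Vertex (W : Type) (k : ℕ) : Type
  /-- the vertices of `H` -/
  | base (w : W)
  /-- the duplicate `z'` of `z` -/
  | dup
  /-- the centre `x` of the star `K_{1,5}` -/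
  | centre
  /-- the leaves of the star; the leaf `0` is `x'` -/
  | leaf (i : Fin 5)
  /-- the vertices other than `x` on the `i`-th copy of `P_6`, in order of distance from `x` -/
  | path (i : Fin k) (j : Fin 5)
  deriving DecidableEq, Fintype

/-- The edges of `attach H z k`, each in one direction at least. -/
def Link {W : Type} (H : SimpleGraph W) (z : W) (k : ℕ) : Vertex W k → Vertex W k → Prop
  | .base a, .base b => H.Adj a b
  | .dup, .base a => a = z ∨ H.Adj z a
  | .centre, .leaf _ => True
  | .base a, .centre => a = z
  | .dup, .leaf i => i = 0
  | .centre, .path _ j => j = 0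
  | .path i j, .path i' j' => i = i' ∧ j'.val = j.val + 1
  | _, _ => False

/-- Duplicate the vertex `z` of `H` (the duplicate `z'` has the same closed neighbourhood as `z`),
add a star `K_{1,5}` with centre `x` and a leaf `x'`, join `z` to `x` and `z'` to `x'`, and
identify one end of each of `k` copies of `P_6` with `x`. -/
def attach {W : Type} (H : SimpleGraph W) (z : W) (k : ℕ) : SimpleGraph (Vertex W k) :=
  SimpleGraph.fromRel (Link H z k)

/-- The edge `e = z'x'`. -/
def specialEdge (W : Type) (k : ℕ) : Sym2 (Vertex W k) :=
  s(.dup, .leaf 0)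

/-- The graph `X_k`. -/
def graphX (k : ℕ) : SimpleGraph (Vertex (Fin 9) k) :=
  attach graphZ 4 k

/-- The graph `Q_k`. -/
def graphQ (k : ℕ) : SimpleGraph (Vertex (Fin 6) k) :=
  attach (SimpleGraph.cycleGraph 6) 0 k

end DominationGame

/-!
The proof rests on the continuation principle `movesLeft_anti`: dominating more vertices in advance
never prolongs the game.

Values of the two families. A pendant path whose last four vertices `a 1, …, a 4` are undominated,
and whose first vertex can dominate nothing new except `a 1`, contributes exactly two moves to the
remainder of the game (`IsFresh.movesLeft_eq`). No single move dominates the four vertices, and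
after any move on the path one more move can finish them, so a player who wants exactly two moves
there answers on the path whenever the opponent plays on it. All `k` paths of `attach H z k` are of
this kind as soon as `x` and its neighbours on them are dominated. This is the case after Dominator
has started with `x`, which gives the upper bound; for the lower bound, these vertices are simply
given to Dominator in advance. In both cases `2 * k` plus the value of a finite game on the part
without paths is left (`gameDominationNumber_attachDel`), and for the finite games involved the two
bounds agree. They are evaluated by an exhaustive search on positions written as bit masks,
`lastsAtLeast` and `lastsAtMost`, whose correctness is `Encodes.le_movesLeft` and
`Encodes.movesLeft_le`.

Small values. If the game on `F` takes at most two moves and `F ≤ G`, the game on `G` takes at most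
three (`gameDominationNumber_le_three`). Indeed, after a good first move of Dominator on `F`, any
vertex that is still undominated dominates all the others that are, since Staller could select it;
so on `G` Dominator repeats this first move and then selects any undominated vertex. Hence
`γ_g(G - e) = 2` excludes `γ_g(G) = 4`, while `γ_g(G - e) = 1` forces `γ_g(G) = 1`.
-/

namespace DominationGame

/-! ### Optimal play -/

section Optimal

variable {V : Type*} [Fintype V] {G : SimpleGraph V} {D E : Finset V} {p : Player} {v : V}

theorem subset_play : D ⊆ play G D v := fun _ hw => mem_play.2 (Or.inl hw)

theorem play_mono (h : D ⊆ E) : play G D v ⊆ play G E v := fun _ hw =>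
  mem_play.2 ((mem_play.1 hw).imp_left fun hD => h hD)

theorem mem_legalMoves_of_subset (h : D ⊆ E) (hv : v ∈ legalMoves G E) : v ∈ legalMoves G D :=
  mem_legalMoves.2 fun hs => mem_legalMoves.1 hv (hs.trans h)

theorem mem_legalMoves_of_notMem {w : V} (hw : w ∉ D) (h : w = v ∨ G.Adj v w) :
    v ∈ legalMoves G D :=
  mem_legalMoves.2 fun hs => hw (hs (mem_closedNbhd.2 h))

theorem movesLeft_eq_zero (h : D = Finset.univ) : movesLeft G p D = 0 := by
  rw [movesLeft, dif_pos h]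

theorem ne_univ_of_mem_legalMoves (hv : v ∈ legalMoves G D) : D ≠ Finset.univ := by
  rintro rfl
  exact mem_legalMoves.1 hv (Finset.subset_univ _)

theorem movesLeft_dominator_le (hv : v ∈ legalMoves G D) :
    movesLeft G .dominator D ≤ movesLeft G .staller (play G D v) + 1 := by
  rw [movesLeft, dif_neg (ne_univ_of_mem_legalMoves hv), add_comm]
  exact Nat.add_le_add_right (Finset.inf'_le
    (fun v : legalMoves G D => movesLeft G .staller (play G D v.1))
    (Finset.mem_attach _ ⟨v, hv⟩)) 1

theorem le_movesLeft_staller (hv : v ∈ legalMoves G D) :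
    movesLeft G .dominator (play G D v) + 1 ≤ movesLeft G .staller D := by
  rw [movesLeft.eq_def G .staller, dif_neg (ne_univ_of_mem_legalMoves hv)]
  dsimp only
  rw [add_comm 1]
  exact Nat.add_le_add_right (Finset.le_sup'
    (fun v : legalMoves G D => movesLeft G .dominator (play G D v.1))
    (Finset.mem_attach _ ⟨v, hv⟩)) 1

theorem exists_movesLeft_dominator (h : D ≠ Finset.univ) : ∃ v ∈ legalMoves G D,
    movesLeft G .dominator D = movesLeft G .staller (play G D v) + 1 := by
  obtain ⟨v, -, hv⟩ := Finset.exists_mem_eq_inf' (Finset.attach_nonempty_iff.2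
    (legalMoves_nonempty (G := G) h)) fun v => movesLeft G .staller (play G D v.1)
  refine ⟨v.1, v.2, ?_⟩
  rw [movesLeft, dif_neg h, add_comm]
  exact congrArg (· + 1) hv

theorem exists_movesLeft_staller (h : D ≠ Finset.univ) : ∃ v ∈ legalMoves G D,
    movesLeft G .staller D = movesLeft G .dominator (play G D v) + 1 := by
  obtain ⟨v, -, hv⟩ := Finset.exists_mem_eq_sup' (Finset.attach_nonempty_iff.2
    (legalMoves_nonempty (G := G) h)) fun v => movesLeft G .dominator (play G D v.1)
  refine ⟨v.1, v.2, ?_⟩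
  rw [movesLeft, dif_neg h]
  dsimp only
  rw [add_comm 1]
  exact congrArg (· + 1) hv

theorem movesLeft_pos (h : D ≠ Finset.univ) : 0 < movesLeft G p D := by
  cases p
  · obtain ⟨v, -, hv⟩ := exists_movesLeft_dominator (G := G) h
    omega
  · obtain ⟨v, -, hv⟩ := exists_movesLeft_staller (G := G) h
    omega

/-- If every legal move ends the game, at most one move is left. -/
theorem movesLeft_le_one (h : ∀ v ∈ legalMoves G D, play G D v = Finset.univ) :
    movesLeft G p D ≤ 1 := by
  by_cases hD : D = Finset.univ
  · simp [movesLeft_eq_zero hD]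
  · cases p
    · obtain ⟨v, hv, he⟩ := exists_movesLeft_dominator (G := G) hD
      rw [he, movesLeft_eq_zero (h v hv)]
    · obtain ⟨v, hv, he⟩ := exists_movesLeft_staller (G := G) hD
      rw [he, movesLeft_eq_zero (h v hv)]

/-- The **continuation principle**: additional dominated vertices never prolong the game, whoever
is to move. If Dominator's reply in the smaller position is illegal in the larger one, he may play
anything there and keeps the inclusion. -/
theorem movesLeft_anti (G : SimpleGraph V) {D E : Finset V} (p : Player) (h : D ⊆ E) :
    movesLeft G p E ≤ movesLeft G p D := by
  by_cases hE : E = Finset.univ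
  · simp [movesLeft_eq_zero hE]
  have hD : D ≠ Finset.univ := fun hD => hE (Finset.univ_subset_iff.1 (hD ▸ h))
  cases p with
  | dominator =>
    obtain ⟨v, hv, hval⟩ := exists_movesLeft_dominator (G := G) hD
    have hlt := card_lt_of_mem_legalMoves hv
    obtain ⟨w, hw, hsub⟩ : ∃ w ∈ legalMoves G E, play G D v ⊆ play G E w := by
      by_cases hvE : v ∈ legalMoves G E
      · exact ⟨v, hvE, play_mono h⟩
      · obtain ⟨w, hw⟩ := legalMoves_nonempty (G := G) hE
        refine ⟨w, hw, fun u hu => subset_play ?_⟩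
        rw [mem_legalMoves, not_not] at hvE
        exact (mem_play.1 hu).elim (fun hu => h hu) fun hu => hvE (mem_closedNbhd.2 hu)
    have := movesLeft_anti G .staller hsub
    have := movesLeft_dominator_le hw
    omega
  | staller =>
    obtain ⟨v, hv, hval⟩ := exists_movesLeft_staller (G := G) hE
    have hvD := mem_legalMoves_of_subset h hv
    have hlt := card_lt_of_mem_legalMoves hvD
    have := movesLeft_anti G .dominator (play_mono (G := G) (v := v) h)
    have := le_movesLeft_staller hvD
    omega
termination_by Fintype.card V - D.card

end Optimal

/-! ### Pendant paths -/

section Path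

variable {V : Type*} {G : SimpleGraph V} {a : Fin 5 → V}

/-- The vertices `a 0, …, a 4` form a path in `G` of which only `a 0` may have further
neighbours. -/
structure IsPendantPath (G : SimpleGraph V) (a : Fin 5 → V) : Prop where
  injective : Function.Injective a
  adj_one (w : V) : G.Adj (a 1) w ↔ w = a 0 ∨ w = a 2
  adj_two (w : V) : G.Adj (a 2) w ↔ w = a 1 ∨ w = a 3
  adj_three (w : V) : G.Adj (a 3) w ↔ w = a 2 ∨ w = a 4
  adj_four (w : V) : G.Adj (a 4) w ↔ w = a 3

theorem IsPendantPath.ne (ha : IsPendantPath G a) {i j : Fin 5} (h : i ≠ j) : a i ≠ a j :=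
  ha.injective.ne h

variable [DecidableEq V] {D : Finset V}

/-- The vertices of a pendant path other than the one through which it is attached. -/
def pathTail (a : Fin 5 → V) : Finset V := {a 1, a 2, a 3, a 4}

theorem mem_pathTail {w : V} :
    w ∈ pathTail a ↔ w = a 1 ∨ w = a 2 ∨ w = a 3 ∨ w = a 4 := by
  simp [pathTail]

theorem IsPendantPath.notMem_pathTail (ha : IsPendantPath G a) {v w : V} (hv : ∀ i, v ≠ a i)
    (h : w = v ∨ G.Adj v w) : w ∉ pathTail a := by
  intro hw
  rcases h with rfl | h
  · rcases mem_pathTail.1 hw with h | h | h | h <;> exact hv _ h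
  · rcases mem_pathTail.1 hw with rfl | rfl | rfl | rfl
    · exact ((ha.adj_one v).1 h.symm).elim (hv 0) (hv 2)
    · exact ((ha.adj_two v).1 h.symm).elim (hv 1) (hv 3)
    · exact ((ha.adj_three v).1 h.symm).elim (hv 2) (hv 4)
    · exact hv 3 ((ha.adj_four v).1 h.symm)

/-- A pendant path is fresh in the position `D` if its last four vertices are undominated and
everything else that its first vertex could dominate is dominated. -/
structure IsFresh (G : SimpleGraph V) (a : Fin 5 → V) (D : Finset V) : Prop where
  notMem : ∀ w ∈ pathTail a, w ∉ D
  first : ∀ w, w = a 0 ∨ G.Adj (a 0) w → w ∈ D ∨ w = a 1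

theorem IsFresh.mem_zero (h : IsFresh G a D) (ha : IsPendantPath G a) : a 0 ∈ D :=
  (h.first _ (Or.inl rfl)).resolve_right (ha.ne (by decide))

variable [Fintype V]

theorem play_union_pathTail {v : V} : play G (D ∪ pathTail a) v = play G D v ∪ pathTail a := by
  ext w
  simp only [mem_play, Finset.mem_union]
  tauto

theorem IsFresh.play (h : IsFresh G a D) (ha : IsPendantPath G a) {v : V} (hv : ∀ i, v ≠ a i) :
    IsFresh G a (play G D v) where
  notMem w hw hmem := (mem_play.1 hmem).elim (h.notMem w hw) fun h' => ha.notMem_pathTail hv h' hw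
  first w hw := (h.first w hw).imp_left fun h' => subset_play h'

theorem IsFresh.play_subset (h : IsFresh G a D) (ha : IsPendantPath G a) (i : Fin 5) :
    DominationGame.play G D (a i) ⊆ D ∪ pathTail a := by
  intro w hw
  have h0 := h.mem_zero ha
  rw [Finset.mem_union, mem_pathTail]
  rw [mem_play] at hw
  fin_cases i
  · have := h.first w
    simp only [Fin.zero_eta, Fin.isValue] at hw
    tauto
  all_goals
    simp only [Fin.mk_one, Fin.reduceFinMk, Fin.isValue, ha.adj_one, ha.adj_two, ha.adj_three,
      ha.adj_four] at hw
    grind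

/-- No vertex of the path dominates its whole tail. -/
theorem IsFresh.exists_notMem_play (h : IsFresh G a D) (ha : IsPendantPath G a) (i : Fin 5) :
    ∃ j, a j ∉ DominationGame.play G D (a i) := by
  have h1 := h.notMem (a 1) (by simp [mem_pathTail])
  have h4 := h.notMem (a 4) (by simp [mem_pathTail])
  have key : a 1 ∉ DominationGame.play G D (a i) ∨ a 4 ∉ DominationGame.play G D (a i) := by
    simp only [mem_play, G.adj_comm (a i), ha.adj_one, ha.adj_four, ha.injective.eq_iff]
    simp only [h1, h4, false_or]
    revert i
    decide
  rcases key with h | h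
  · exact ⟨1, h⟩
  · exact ⟨4, h⟩

/-- After any move on a fresh path, its tail can be finished with one more move. -/
theorem IsFresh.exists_reply (h : IsFresh G a D) (ha : IsPendantPath G a) (i : Fin 5) :
    ∃ j, a j ∈ legalMoves G (DominationGame.play G D (a i)) ∧
      D ∪ pathTail a ⊆ DominationGame.play G (DominationGame.play G D (a i)) (a j) := by
  have h1 := h.notMem (a 1) (by simp [mem_pathTail])
  have h4 := h.notMem (a 4) (by simp [mem_pathTail])
  -- The reply is `a 3` if `a 4` is still undominated, and `a 1` otherwise.
  refine ⟨if i ≤ 2 then 3 else 1, ?_, fun w hw => ?_⟩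
  · split_ifs with hi
    · refine mem_legalMoves_of_notMem (w := a 4) ?_ (by simp [ha.adj_three])
      rw [mem_play, G.adj_comm, ha.adj_four, ha.injective.eq_iff, ha.injective.eq_iff]
      simp only [h4, false_or]
      revert i
      decide
    · refine mem_legalMoves_of_notMem (w := a 1) ?_ (by simp)
      rw [mem_play, G.adj_comm, ha.adj_one, ha.injective.eq_iff, ha.injective.eq_iff,
        ha.injective.eq_iff]
      simp only [h1, false_or]
      revert i
      decide
  · rw [Finset.mem_union, mem_pathTail] at hw
    have h01 : G.Adj (a 0) (a 1) := ((ha.adj_one _).2 (Or.inl rfl)).symm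
    rw [mem_play, mem_play]
    fin_cases i <;>
      simp [ha.adj_one, ha.adj_two, ha.adj_three, ha.adj_four] <;> grind

theorem IsFresh.movesLeft_add_two_le (ha : IsPendantPath G a) (p : Player) {D : Finset V}
    (h : IsFresh G a D) : movesLeft G p (D ∪ pathTail a) + 2 ≤ movesLeft G p D := by
  have hD : D ≠ Finset.univ := fun hD =>
    h.notMem (a 1) (by simp [mem_pathTail]) (hD ▸ Finset.mem_univ _)
  cases p with
  | dominator =>
    obtain ⟨v, hv, hval⟩ := exists_movesLeft_dominator (G := G) hD
    have hlt := card_lt_of_mem_legalMoves hv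
    by_cases hva : ∃ i, v = a i
    · -- Staller answers in the same path.
      obtain ⟨i, rfl⟩ := hva
      obtain ⟨j, hjD⟩ := h.exists_notMem_play ha i
      have h1 := le_movesLeft_staller (mem_legalMoves_of_notMem (G := G) hjD (Or.inl rfl))
      have hsub : DominationGame.play G (DominationGame.play G D (a i)) (a j) ⊆ D ∪ pathTail a := by
        intro w hw
        rcases mem_play.1 hw with hw | hw
        · exact h.play_subset ha i hw
        · exact h.play_subset ha j (mem_play.2 (Or.inr hw))
      have := movesLeft_anti G .dominator hsub
      omega
    · push Not at hva
      have hvE : v ∈ legalMoves G (D ∪ pathTail a) := by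
        rw [mem_legalMoves, Finset.not_subset] at hv ⊢
        obtain ⟨w, hw, hwD⟩ := hv
        refine ⟨w, hw, fun hwE => (Finset.mem_union.1 hwE).elim hwD ?_⟩
        exact ha.notMem_pathTail hva (mem_closedNbhd.1 hw)
      have h1 := movesLeft_dominator_le hvE
      rw [play_union_pathTail] at h1
      have := IsFresh.movesLeft_add_two_le ha .staller (h.play ha hva)
      omega
  | staller =>
    by_cases hE : D ∪ pathTail a = Finset.univ
    · rw [movesLeft_eq_zero hE]
      -- Staller plays `a 1`, which leaves a vertex of the tail undominated.
      obtain ⟨j, hjD⟩ := h.exists_notMem_play ha 1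
      have h1 := le_movesLeft_staller (mem_legalMoves_of_notMem (G := G)
        (h.notMem (a 1) (by simp [mem_pathTail])) (Or.inl rfl))
      have := movesLeft_pos (G := G) (p := .dominator)
        (fun hu : DominationGame.play G D (a 1) = Finset.univ => hjD (hu ▸ Finset.mem_univ _))
      omega
    · obtain ⟨v, hv, hval⟩ := exists_movesLeft_staller (G := G) hE
      have hvD := mem_legalMoves_of_subset Finset.subset_union_left hv
      have hlt := card_lt_of_mem_legalMoves hvD
      have hva : ∀ i, v ≠ a i := by
        rintro i rfl
        exact mem_legalMoves.1 hv fun w hw =>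
          h.play_subset ha i (mem_play.2 (Or.inr (mem_closedNbhd.1 hw)))
      have h1 := le_movesLeft_staller hvD
      rw [play_union_pathTail] at hval
      have := IsFresh.movesLeft_add_two_le ha .dominator (h.play ha hva)
      omega
termination_by Fintype.card V - D.card

theorem IsFresh.movesLeft_le_add_two (ha : IsPendantPath G a) (p : Player) {D : Finset V}
    (h : IsFresh G a D) : movesLeft G p D ≤ movesLeft G p (D ∪ pathTail a) + 2 := by
  have hD : D ≠ Finset.univ := fun hD =>
    h.notMem (a 1) (by simp [mem_pathTail]) (hD ▸ Finset.mem_univ _)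
  cases p with
  | dominator =>
    by_cases hE : D ∪ pathTail a = Finset.univ
    · -- Dominator plays `a 2` and leaves a single undominated vertex, `a 4`.
      have h1 := movesLeft_dominator_le (mem_legalMoves_of_notMem (G := G)
        (h.notMem (a 2) (by simp [mem_pathTail])) (Or.inl rfl))
      have h4 : ∀ w, w ∉ DominationGame.play G D (a 2) → w = a 4 := by
        intro w hw
        have : w ∈ D ∪ pathTail a := hE ▸ Finset.mem_univ w
        rw [Finset.mem_union, mem_pathTail] at this
        rw [mem_play, ha.adj_two] at hw
        tauto
      have : movesLeft G .staller (DominationGame.play G D (a 2)) ≤ 1 := by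
        refine movesLeft_le_one fun v hv => Finset.eq_univ_iff_forall.2 fun w => ?_
        rw [mem_legalMoves, Finset.not_subset] at hv
        obtain ⟨u, hu, huD⟩ := hv
        by_contra hw
        have hwu : w = u := (h4 w fun h' => hw (subset_play h')).trans (h4 u huD).symm
        exact hw (mem_play.2 (Or.inr (hwu ▸ mem_closedNbhd.1 hu)))
      omega
    · obtain ⟨v, hv, hval⟩ := exists_movesLeft_dominator (G := G) hE
      have hvD := mem_legalMoves_of_subset Finset.subset_union_left hv
      have hlt := card_lt_of_mem_legalMoves hvD
      have hva : ∀ i, v ≠ a i := by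
        rintro i rfl
        exact mem_legalMoves.1 hv fun w hw =>
          h.play_subset ha i (mem_play.2 (Or.inr (mem_closedNbhd.1 hw)))
      have h1 := movesLeft_dominator_le hvD
      rw [play_union_pathTail] at hval
      have := IsFresh.movesLeft_le_add_two ha .staller (h.play ha hva)
      omega
  | staller =>
    obtain ⟨v, hv, hval⟩ := exists_movesLeft_staller (G := G) hD
    have hlt := card_lt_of_mem_legalMoves hv
    by_cases hva : ∃ i, v = a i
    · -- Dominator finishes the path.
      obtain ⟨i, rfl⟩ := hva
      obtain ⟨j, hj, hsub⟩ := h.exists_reply ha i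
      have := movesLeft_dominator_le hj
      have := movesLeft_anti G .staller hsub
      omega
    · push Not at hva
      have hvE : v ∈ legalMoves G (D ∪ pathTail a) := by
        rw [mem_legalMoves, Finset.not_subset] at hv ⊢
        obtain ⟨w, hw, hwD⟩ := hv
        refine ⟨w, hw, fun hwE => (Finset.mem_union.1 hwE).elim hwD ?_⟩
        exact ha.notMem_pathTail hva (mem_closedNbhd.1 hw)
      have h1 := le_movesLeft_staller hvE
      rw [play_union_pathTail] at h1
      have := IsFresh.movesLeft_le_add_two ha .dominator (h.play ha hva)
      omega
termination_by Fintype.card V - D.card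

/-- A fresh pendant path contributes exactly two moves to the remainder of the game: a player who
wants this answers every move on the path by a move on the path. -/
theorem IsFresh.movesLeft_eq (ha : IsPendantPath G a) (p : Player) (h : IsFresh G a D) :
    movesLeft G p D = movesLeft G p (D ∪ pathTail a) + 2 :=
  le_antisymm (h.movesLeft_le_add_two ha p) (h.movesLeft_add_two_le ha p)

/-- Several fresh pendant paths with disjoint tails contribute two moves each. -/
theorem movesLeft_eq_of_forall_isFresh {ι : Type*} [DecidableEq ι] {a : ι → Fin 5 → V}
    (ha : ∀ i, IsPendantPath G (a i)) (h : ∀ i, IsFresh G (a i) D)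
    (hdisj : ∀ i j, i ≠ j → Disjoint (pathTail (a i)) (pathTail (a j))) (p : Player)
    (s : Finset ι) :
    movesLeft G p D = movesLeft G p (D ∪ s.biUnion fun i => pathTail (a i)) + 2 * s.card := by
  induction s using Finset.induction_on with
  | empty => simp
  | insert i s hi ih =>
    have hfresh : IsFresh G (a i) (D ∪ s.biUnion fun i => pathTail (a i)) := by
      refine ⟨fun w hw hmem => ?_, fun w hw => ?_⟩
      · rcases Finset.mem_union.1 hmem with hmem | hmem
        · exact (h i).notMem w hw hmem
        · obtain ⟨j, hj, hwj⟩ := Finset.mem_biUnion.1 hmem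
          exact Finset.disjoint_left.1 (hdisj i j fun hij => hi (hij ▸ hj)) hw hwj
      · exact ((h i).first w hw).imp_left fun hwD => Finset.mem_union_left _ hwD
    rw [ih, hfresh.movesLeft_eq (ha i), Finset.card_insert_of_notMem hi, Finset.biUnion_insert,
      Finset.union_assoc, Finset.union_comm (pathTail _)]
    ring

end Path

/-! ### Small game domination numbers -/

section Small

variable {V : Type*} [Fintype V] {F G : SimpleGraph V}

/-- If the game on `F` takes at most two moves, Dominator needs at most three on every graph
`G ⊇ F` with the same vertices: on `F`, after his first move every undominated vertex dominates
all the others that are left, so on `G` he starts in the same way and afterwards plays any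
undominated vertex. -/
theorem gameDominationNumber_le_three (hFG : F ≤ G) (h : gameDominationNumber F ≤ 2) :
    gameDominationNumber G ≤ 3 := by
  by_cases hV : (∅ : Finset V) = Finset.univ
  · simp [gameDominationNumber, movesLeft_eq_zero hV]
  obtain ⟨v, -, hv⟩ := exists_movesLeft_dominator (G := F) hV
  rw [gameDominationNumber, hv] at h
  have key : ∀ w ∉ play F ∅ v, play F (play F ∅ v) w = Finset.univ := by
    intro w hw
    by_contra hne
    have := le_movesLeft_staller (mem_legalMoves_of_notMem (G := F) hw (Or.inl rfl))
    have := movesLeft_pos (G := F) (p := .dominator) hne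
    omega
  have h1 : gameDominationNumber G ≤ movesLeft G .staller (play G ∅ v) + 1 :=
    movesLeft_dominator_le
      (mem_legalMoves_of_notMem (G := G) (Finset.notMem_empty v) (Or.inl rfl))
  by_cases hD : play G ∅ v = Finset.univ
  · rw [movesLeft_eq_zero hD] at h1
    omega
  obtain ⟨s, -, hs⟩ := exists_movesLeft_staller (G := G) hD
  by_cases hE : play G (play G ∅ v) s = Finset.univ
  · rw [movesLeft_eq_zero hE] at hs
    omega
  obtain ⟨w, hw⟩ : ∃ w, w ∉ play G (play G ∅ v) s := by
    simpa [Finset.eq_univ_iff_forall] using hE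
  have h2 := movesLeft_dominator_le (mem_legalMoves_of_notMem (G := G) hw (Or.inl rfl))
  have hw' : w ∉ play F ∅ v := fun hmem => hw <| subset_play <|
    mem_play.2 ((mem_play.1 hmem).imp_right (Or.imp_right fun h => hFG h))
  have h3 : play G (play G (play G ∅ v) s) w = Finset.univ := by
    refine Finset.eq_univ_iff_forall.2 fun u => ?_
    have hu : u ∈ play F (play F ∅ v) w := key w hw' ▸ Finset.mem_univ u
    rw [mem_play, mem_play] at hu
    rw [mem_play, mem_play, mem_play]
    have := @hFG v u
    have := @hFG w u
    tauto
  rw [movesLeft_eq_zero h3] at h2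
  omega

/-- A single move that ends the game on `F` also ends it on every graph `G ⊇ F` with the same
vertices. -/
theorem gameDominationNumber_le_one (hFG : F ≤ G) (h : gameDominationNumber F ≤ 1) :
    gameDominationNumber G ≤ 1 := by
  by_cases hV : (∅ : Finset V) = Finset.univ
  · simp [gameDominationNumber, movesLeft_eq_zero hV]
  obtain ⟨v, -, hv⟩ := exists_movesLeft_dominator (G := F) hV
  rw [gameDominationNumber, hv] at h
  have huniv : play F ∅ v = Finset.univ := by
    by_contra hne
    have := movesLeft_pos (G := F) (p := .staller) hne
    omega
  have h1 : gameDominationNumber G ≤ movesLeft G .staller (play G ∅ v) + 1 :=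
    movesLeft_dominator_le
      (mem_legalMoves_of_notMem (G := G) (Finset.notMem_empty v) (Or.inl rfl))
  have h2 : play G ∅ v = Finset.univ := by
    refine Finset.eq_univ_iff_forall.2 fun u => ?_
    have hu : u ∈ play F ∅ v := huniv ▸ Finset.mem_univ u
    rw [mem_play] at hu ⊢
    exact hu.imp_right (Or.imp_right fun h => hFG h)
  rwa [movesLeft_eq_zero h2] at h1

theorem gameDominationNumber_add_two_ne (hFG : F ≤ G) (h : gameDominationNumber G ≤ 4) :
    gameDominationNumber F + 2 ≠ gameDominationNumber G := by
  intro heq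
  have h3 := gameDominationNumber_le_three hFG (by omega)
  have h1 := gameDominationNumber_le_one hFG (by omega)
  omega

end Small

/-! ### Positions as bit masks -/

section Mask

/-- Whether the game lasts at least `t` more moves from the position `m`, where vertices are
numbered and sets of vertices are written as binary numbers; `N` lists the closed neighbourhoods. -/
def lastsAtLeast (N : List ℕ) : Player → ℕ → ℕ → Bool
  | _, 0, _ => true
  | .dominator, t + 1, m => m != 2 ^ N.length - 1 &&
      N.all fun a => m ||| a == m || lastsAtLeast N .staller t (m ||| a)
  | .staller, t + 1, m => N.any fun a => m ||| a != m && lastsAtLeast N .dominator t (m ||| a)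

/-- Whether the game lasts at most `t` more moves from the position `m`. -/
def lastsAtMost (N : List ℕ) : Player → ℕ → ℕ → Bool
  | _, 0, m => m == 2 ^ N.length - 1
  | .dominator, t + 1, m => m == 2 ^ N.length - 1 ||
      N.any fun a => m ||| a != m && lastsAtMost N .staller t (m ||| a)
  | .staller, t + 1, m => N.all fun a => m ||| a == m || lastsAtMost N .dominator t (m ||| a)

variable {V : Type*} {G : SimpleGraph V} {N : List ℕ} {ι : Fin N.length → V}

/-- The list `N` consists of the closed neighbourhoods of the vertices `ι i`, traced on the range
of `ι`. -/
structure IsEncoding (G : SimpleGraph V) (N : List ℕ) (ι : Fin N.length → V) : Prop where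
  testBit (i j : Fin N.length) : N[i].testBit j = true ↔ ι j = ι i ∨ G.Adj (ι i) (ι j)
  lt (i : Fin N.length) : N[i] < 2 ^ N.length

variable [Fintype V] {D : Finset V} {m m' : ℕ}

/-- The number `m` describes the position `D`: its digits tell which of the vertices `ι i` are
dominated, and no other vertex can be selected any more. -/
structure Encodes (G : SimpleGraph V) (ι : Fin N.length → V) (D : Finset V) (m : ℕ) : Prop where
  testBit (j : Fin N.length) : m.testBit j = true ↔ ι j ∈ D
  lt : m < 2 ^ N.length
  rest (v : V) (hv : v ∉ Set.range ι) : closedNbhd G v ⊆ D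

namespace Encodes

theorem unique (h : Encodes G ι D m) (h' : Encodes G ι D m') : m = m' := by
  refine Nat.eq_of_testBit_eq fun j => ?_
  by_cases hj : j < N.length
  · exact Bool.eq_iff_iff.2 ((h.testBit ⟨j, hj⟩).trans (h'.testBit ⟨j, hj⟩).symm)
  · have hle := Nat.pow_le_pow_right (n := 2) (by norm_num) (not_lt.1 hj)
    rw [Nat.testBit_lt_two_pow (h.lt.trans_le hle), Nat.testBit_lt_two_pow (h'.lt.trans_le hle)]

theorem play (h : Encodes G ι D m) (hN : IsEncoding G N ι) (i : Fin N.length) :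
    Encodes G ι (play G D (ι i)) (m ||| N[i]) where
  testBit j := by
    rw [Nat.testBit_or, Bool.or_eq_true, h.testBit, hN.testBit, mem_play]
  lt := Nat.or_lt_two_pow h.lt (hN.lt i)
  rest v hv := (h.rest v hv).trans subset_play

theorem mem_of_notMem_range (h : Encodes G ι D m) {v : V} (hv : v ∉ Set.range ι) : v ∈ D :=
  h.rest v hv (mem_closedNbhd.2 (Or.inl rfl))

theorem mem_legalMoves_iff (h : Encodes G ι D m) (hN : IsEncoding G N ι) (i : Fin N.length) :
    ι i ∈ legalMoves G D ↔ m ||| N[i] ≠ m := by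
  rw [mem_legalMoves, ne_eq, not_iff_not]
  refine ⟨fun hs => ?_, fun hm w hw => ?_⟩
  · have hD : DominationGame.play G D (ι i) = D := by
      refine Finset.Subset.antisymm (fun w hw => ?_) subset_play
      exact (mem_play.1 hw).elim id fun hw => hs (mem_closedNbhd.2 hw)
    have h' := h.play hN i
    rw [hD] at h'
    exact h'.unique h
  · by_cases hr : w ∈ Set.range ι
    · obtain ⟨j, rfl⟩ := hr
      rw [← h.testBit, ← hm, (h.play hN i).testBit]
      exact mem_play.2 (Or.inr (mem_closedNbhd.1 hw))
    · exact h.mem_of_notMem_range hr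

theorem exists_of_mem_legalMoves (h : Encodes G ι D m) {v : V} (hv : v ∈ legalMoves G D) :
    ∃ i, ι i = v := by
  by_contra hr
  exact mem_legalMoves.1 hv (h.rest v hr)

theorem eq_univ_iff (h : Encodes G ι D m) : D = Finset.univ ↔ m = 2 ^ N.length - 1 := by
  constructor
  · rintro rfl
    refine h.unique ⟨fun j => ?_, Nat.sub_lt (by positivity) one_pos,
      fun v _ => Finset.subset_univ _⟩
    simp [Nat.testBit_two_pow_sub_one]
  · rintro rfl
    refine Finset.eq_univ_iff_forall.2 fun v => ?_
    by_cases hr : v ∈ Set.range ι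
    · obtain ⟨j, rfl⟩ := hr
      rw [← h.testBit]
      simp [Nat.testBit_two_pow_sub_one]
    · exact h.mem_of_notMem_range hr

theorem le_movesLeft (hN : IsEncoding G N ι) {t : ℕ} : ∀ {p : Player} {D : Finset V} {m : ℕ},
    Encodes G ι D m → lastsAtLeast N p t m = true → t ≤ movesLeft G p D := by
  induction t with
  | zero => exact fun _ _ => Nat.zero_le _
  | succ t ih =>
    intro p D m h ht
    cases p with
    | dominator =>
      simp only [lastsAtLeast, Bool.and_eq_true, bne_iff_ne, ne_eq, List.all_eq_true,
        Bool.or_eq_true, beq_iff_eq, ← h.eq_univ_iff] at ht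
      obtain ⟨v, hv, hval⟩ := exists_movesLeft_dominator (G := G) ht.1
      obtain ⟨i, rfl⟩ := h.exists_of_mem_legalMoves hv
      have := ih (h.play hN i) ((ht.2 N[i] (List.getElem_mem _)).resolve_left
        ((h.mem_legalMoves_iff hN i).1 hv))
      omega
    | staller =>
      simp only [lastsAtLeast, List.any_eq_true, Bool.and_eq_true, bne_iff_ne, ne_eq] at ht
      obtain ⟨a, ha, hm, ht⟩ := ht
      obtain ⟨i, hi, rfl⟩ := List.mem_iff_getElem.1 ha
      have h1 := le_movesLeft_staller ((h.mem_legalMoves_iff hN ⟨i, hi⟩).2 hm)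
      have := ih (h.play hN ⟨i, hi⟩) ht
      omega

theorem movesLeft_le (hN : IsEncoding G N ι) {t : ℕ} : ∀ {p : Player} {D : Finset V} {m : ℕ},
    Encodes G ι D m → lastsAtMost N p t m = true → movesLeft G p D ≤ t := by
  induction t with
  | zero =>
    intro p D m h ht
    simp only [lastsAtMost, beq_iff_eq, ← h.eq_univ_iff] at ht
    simp [movesLeft_eq_zero ht]
  | succ t ih =>
    intro p D m h ht
    by_cases hD : D = Finset.univ
    · simp [movesLeft_eq_zero hD]
    cases p with
    | dominator =>
      simp only [lastsAtMost, Bool.or_eq_true, beq_iff_eq, ← h.eq_univ_iff, hD, false_or,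
        List.any_eq_true, Bool.and_eq_true, bne_iff_ne, ne_eq] at ht
      obtain ⟨a, ha, hm, ht⟩ := ht
      obtain ⟨i, hi, rfl⟩ := List.mem_iff_getElem.1 ha
      have h1 := movesLeft_dominator_le ((h.mem_legalMoves_iff hN ⟨i, hi⟩).2 hm)
      have := ih (h.play hN ⟨i, hi⟩) ht
      omega
    | staller =>
      simp only [lastsAtMost, List.all_eq_true, Bool.or_eq_true, beq_iff_eq] at ht
      obtain ⟨v, hv, hval⟩ := exists_movesLeft_staller (G := G) hD
      obtain ⟨i, rfl⟩ := h.exists_of_mem_legalMoves hv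
      have := ih (h.play hN i) ((ht N[i] (List.getElem_mem _)).resolve_left
        ((h.mem_legalMoves_iff hN i).1 hv))
      omega

end Encodes
end Mask

/-! ### The attached paths -/

section Attach

variable {W : Type} {H : SimpleGraph W} {z : W} {k : ℕ} {del : Bool}

/-- The graph `attach H z k`, with the edge `z'x'` deleted if `del` holds. -/
def attachDel (H : SimpleGraph W) (z : W) (k : ℕ) (del : Bool) : SimpleGraph (Vertex W k) :=
  (attach H z k).deleteEdges {e | del = true ∧ e = specialEdge W k}

theorem attachDel_false : attachDel H z k false = attach H z k := by
  simp [attachDel]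

theorem attachDel_true :
    attachDel H z k true = (attach H z k).deleteEdges {specialEdge W k} := by
  simp [attachDel]

theorem attachDel_adj {v w : Vertex W k} : (attachDel H z k del).Adj v w ↔
    (v ≠ w ∧ (Link H z k v w ∨ Link H z k w v)) ∧ ¬ (del = true ∧ s(v, w) = specialEdge W k) := by
  simp [attachDel, attach]

instance [DecidableEq W] [DecidableRel H.Adj] : DecidableRel (Link H z k) := fun v w => by
  cases v <;> cases w <;> dsimp only [Link] <;> infer_instance

instance [DecidableEq W] [DecidableRel H.Adj] : DecidableRel (attachDel H z k del).Adj :=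
  fun v w => decidable_of_iff
    ((v ≠ w ∧ (Link H z k v w ∨ Link H z k w v)) ∧ ¬ (del = true ∧ s(v, w) = s(.dup, .leaf 0)))
    attachDel_adj.symm

/-- The vertices off the attached paths, as vertices of the whole graph. -/
def ofCore (k : ℕ) : Vertex W 0 → Vertex W k
  | .base w => .base w
  | .dup => .dup
  | .centre => .centre
  | .leaf i => .leaf i
  | .path i _ => i.elim0

theorem ofCore_injective : Function.Injective (ofCore (W := W) k) := by
  rintro (_ | _ | _ | _ | ⟨i, _⟩) (_ | _ | _ | _ | ⟨j, _⟩) h <;>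
    first | exact i.elim0 | exact j.elim0 | simp_all [ofCore]

theorem attachDel_adj_ofCore {v w : Vertex W 0} :
    (attachDel H z k del).Adj (ofCore k v) (ofCore k w) ↔ (attachDel H z 0 del).Adj v w := by
  have hs : s(ofCore k v, ofCore k w) = specialEdge W k ↔ s(v, w) = specialEdge W 0 := by
    rw [show specialEdge W k = (specialEdge W 0).map (ofCore k) from rfl, ← Sym2.map_mk,
      (Sym2.map.injective ofCore_injective).eq_iff]
  have hl (v w : Vertex W 0) : Link H z k (ofCore k v) (ofCore k w) ↔ Link H z 0 v w := by
    rcases v with _ | _ | _ | _ | ⟨i, _⟩ <;> rcases w with _ | _ | _ | _ | ⟨j, _⟩ <;>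
      first | exact i.elim0 | exact j.elim0 | rfl
  rw [attachDel_adj, attachDel_adj, hs, hl, hl, ofCore_injective.ne_iff]

theorem isPendantPath_path (i : Fin k) :
    IsPendantPath (attachDel H z k del) fun j => Vertex.path i j where
  injective _ _ h := by simpa using h
  adj_one w := by
    rw [attachDel_adj]
    cases w <;> simp [Link, specialEdge]
    grind
  adj_two w := by
    rw [attachDel_adj]
    cases w <;> simp [Link, specialEdge]
    grind
  adj_three w := by
    rw [attachDel_adj]
    cases w <;> simp [Link, specialEdge]
    grind
  adj_four w := by
    rw [attachDel_adj]
    cases w <;> simp [Link, specialEdge]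
    grind

theorem attachDel_adj_path_zero {i : Fin k} {w : Vertex W k} :
    (attachDel H z k del).Adj (.path i 0) w ↔ w = .centre ∨ w = .path i 1 := by
  rw [attachDel_adj]
  cases w <;> simp [Link, specialEdge]
  grind

end Attach

section AttachGame

variable {W : Type} {H : SimpleGraph W} {z : W} {k : ℕ} {del : Bool}

theorem mem_range_ofCore_comp {n : ℕ} {ι : Fin n → Vertex W 0} (hι : Function.Surjective ι)
    {v : Vertex W k} (hv : v ∉ Set.range (ofCore k ∘ ι)) : ∃ i j, v = .path i j := by
  rw [hι.range_comp] at hv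
  cases v with
  | base w => exact absurd ⟨.base w, rfl⟩ hv
  | dup => exact absurd ⟨.dup, rfl⟩ hv
  | centre => exact absurd ⟨.centre, rfl⟩ hv
  | leaf i => exact absurd ⟨.leaf i, rfl⟩ hv
  | path i j => exact ⟨i, j, rfl⟩

variable [Fintype W] [DecidableEq W]

/-- Once `x` and its neighbours on the attached paths are dominated, every path accounts for two
moves, and the other moves are those of the game off the paths. -/
theorem exists_encodes {N : List ℕ} {ι : Fin N.length → Vertex W 0} (hι : Function.Surjective ι)
    {D : Finset (Vertex W k)} {m : ℕ} (hm : m < 2 ^ N.length)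
    (hmD : ∀ j : Fin N.length, m.testBit j = true ↔ ofCore k (ι j) ∈ D) (hx : .centre ∈ D)
    (hD : ∀ (i : Fin k) (j : Fin 5), .path i j ∈ D ↔ j = 0) (p : Player) :
    ∃ E : Finset (Vertex W k), Encodes (attachDel H z k del) (ofCore k ∘ ι) E m ∧
      movesLeft (attachDel H z k del) p D = movesLeft (attachDel H z k del) p E + 2 * k := by
  have hfresh (i : Fin k) : IsFresh (attachDel H z k del) (fun j => Vertex.path i j) D := by
    refine ⟨fun w hw => ?_, fun w hw => ?_⟩
    · rcases mem_pathTail.1 hw with rfl | rfl | rfl | rfl <;> simp [hD]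
    · rw [attachDel_adj_path_zero] at hw
      rcases hw with rfl | rfl | rfl <;> simp [hD, hx]
  have hdisj (i j : Fin k) (hij : i ≠ j) : Disjoint (pathTail fun l => Vertex.path (W := W) i l)
      (pathTail fun l => Vertex.path j l) := by
    refine Finset.disjoint_left.2 fun w hw hw' => hij ?_
    rw [mem_pathTail] at hw hw'
    grind
  have hval := movesLeft_eq_of_forall_isFresh (fun i => isPendantPath_path i) hfresh hdisj p
    Finset.univ
  rw [Finset.card_univ, Fintype.card_fin] at hval
  refine ⟨_, ⟨fun j => ?_, hm, fun v hv w hw => ?_⟩, hval⟩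
  · rw [hmD, Function.comp_apply, Finset.mem_union, iff_self_or]
    generalize ι j = u
    intro h
    obtain ⟨i, -, hi⟩ := Finset.mem_biUnion.1 h
    rw [mem_pathTail] at hi
    rcases u with _ | _ | _ | _ | ⟨i, _⟩
    case path => exact i.elim0
    all_goals simp [ofCore] at hi
  · have hpath (i : Fin k) (j : Fin 5) : Vertex.path i j ∈
        D ∪ Finset.univ.biUnion fun i => pathTail fun j => Vertex.path i j := by
      rw [Finset.mem_union, hD, Finset.mem_biUnion]
      by_cases hj : j = 0
      · exact Or.inl hj
      · refine Or.inr ⟨i, Finset.mem_univ _, ?_⟩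
        rw [mem_pathTail]
        fin_cases j <;> simp_all
    obtain ⟨i, j, rfl⟩ := mem_range_ofCore_comp hι hv
    rw [mem_closedNbhd, attachDel_adj] at hw
    cases w with
    | path i' j' => exact hpath i' j'
    | centre => exact Finset.mem_union_left _ hx
    | _ => simp [Link] at hw

/-- The value of `attachDel H z k del` from two finite games off the paths. For the lower bound,
`x` and its neighbours on the paths are given to Dominator in advance; for the upper bound,
Dominator starts with `x`. -/
theorem gameDominationNumber_attachDel {N : List ℕ} {ι : Fin N.length → Vertex W 0}
    (hι : Function.Bijective ι) (hN : IsEncoding (attachDel H z 0 del) N ι) {x : Fin N.length}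
    (hx : ι x = .centre) {c : ℕ} (hlow : lastsAtLeast N .dominator (c + 1) (2 ^ x.val) = true)
    (hup : lastsAtMost N .staller c N[x] = true) :
    gameDominationNumber (attachDel H z k del) = 2 * k + (c + 1) := by
  have hNk : IsEncoding (attachDel H z k del) N (ofCore k ∘ ι) := by
    refine ⟨fun i j => ?_, hN.lt⟩
    rw [hN.testBit, Function.comp_apply, Function.comp_apply, ofCore_injective.eq_iff,
      attachDel_adj_ofCore]
  apply le_antisymm
  · have hxk : ofCore k (ι x) = .centre := by rw [hx]; rfl
    have hfirst := movesLeft_dominator_le (mem_legalMoves_of_notMem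
      (G := attachDel H z k del) (Finset.notMem_empty .centre) (Or.inl rfl))
    obtain ⟨E, hE, hval⟩ := exists_encodes (H := H) (z := z) (del := del) (k := k) hι.2
      (D := play (attachDel H z k del) ∅ .centre) (hN.lt x) (fun j => by
        rw [hNk.testBit, Function.comp_apply, Function.comp_apply, hxk, mem_play]
        simp) (mem_play.2 (Or.inr (Or.inl rfl))) (fun i j => by
        rw [mem_play, attachDel_adj]
        simp [Link, specialEdge]) .staller
    have := hE.movesLeft_le hNk hup
    rw [gameDominationNumber]
    omega
  · obtain ⟨E, hE, hval⟩ := exists_encodes (H := H) (z := z) (del := del) (k := k) hι.2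
      (D := insert .centre (Finset.univ.image fun i => .path i 0))
      (Nat.pow_lt_pow_right (by norm_num) x.2) (fun j => by
        rw [Nat.testBit_two_pow]
        have hj : x = j ↔ ι j = .centre := by rw [← hx, hι.1.eq_iff, eq_comm]
        rw [decide_eq_true_iff, Fin.val_inj, hj]
        rcases ι j with _ | _ | _ | _ | ⟨i, _⟩
        case path => exact i.elim0
        all_goals simp [ofCore]) (Finset.mem_insert_self _ _) (fun i j => by
        simp [eq_comm]) .dominator
    have := hE.le_movesLeft hNk hlow
    have := movesLeft_anti (attachDel H z k del) .dominator
      (Finset.empty_subset (insert .centre (Finset.univ.image fun i => .path i 0)))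
    rw [gameDominationNumber]
    omega

end AttachGame

section Connected

variable {W : Type} {H : SimpleGraph W} {z : W} {k : ℕ}

theorem specialEdge_mem_edgeSet : specialEdge W k ∈ (attach H z k).edgeSet := by
  simp [specialEdge, attach, Link]

theorem attach_connected (hH : H.Connected) : (attach H z k).Connected := by
  have adj {v w : Vertex W k} (h : Link H z k v w) (hne : v ≠ w) :
      (attach H z k).Reachable v w :=
    SimpleGraph.Adj.reachable ((SimpleGraph.fromRel_adj _ _ _).2 ⟨hne, Or.inl h⟩)
  have hzx : (attach H z k).Reachable (.base z) .centre := adj (by simp [Link]) (by simp)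
  have hpath (i : Fin k) (n : ℕ) (hn : n < 5) :
      (attach H z k).Reachable (.path i ⟨n, hn⟩) .centre := by
    induction n with
    | zero => exact (adj (v := .centre) (by simp [Link]) (by simp)).symm
    | succ n ih =>
      exact (adj (v := .path i ⟨n, by omega⟩) (by simp [Link]) (by simp)).symm.trans
        (ih (by omega))
  have hcentre (v : Vertex W k) : (attach H z k).Reachable v .centre := by
    cases v with
    | base w =>
      refine SimpleGraph.Reachable.trans ?_ hzx
      refine (hH.preconnected w z).map ⟨Vertex.base, fun {a b} hab => ?_⟩
      exact (SimpleGraph.fromRel_adj _ _ _).2 ⟨by simpa using hab.ne, Or.inl hab⟩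
    | dup => exact (adj (w := .base z) (by simp [Link]) (by simp)).trans hzx
    | centre => exact SimpleGraph.Reachable.rfl
    | leaf i => exact (adj (v := .centre) (by simp [Link]) (by simp)).symm
    | path i j => exact hpath i j.1 j.2
  have : Nonempty (Vertex W k) := ⟨.centre⟩
  exact ⟨fun v w => (hcentre v).trans (hcentre w).symm⟩

end Connected

/-! ### The two families -/

instance : DecidableRel graphZ.Adj := fun v w => decidable_of_iff
  (s(v, w) ∈ ([s(0, 1), s(1, 2), s(2, 3), s(3, 4), s(4, 5), s(5, 6), s(6, 7), s(7, 0),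
     s(1, 6), s(2, 5), s(8, 3), s(8, 4), s(8, 5)] : List (Sym2 (Fin 9))) ∧ v ≠ w) (by
  simp [graphZ])

/-- The vertices of `Z_0` in the order used for bit masks. -/
def verticesX : Fin 16 → Vertex (Fin 9) 0 :=
  ![.base 0, .base 1, .base 2, .base 3, .base 4, .base 5, .base 6, .base 7, .base 8, .dup,
    .centre, .leaf 0, .leaf 1, .leaf 2, .leaf 3, .leaf 4]

/-- The vertices of `(C_6)_0` in the order used for bit masks. -/
def verticesQ : Fin 13 → Vertex (Fin 6) 0 :=
  ![.base 0, .base 1, .base 2, .base 3, .base 4, .base 5, .dup,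
    .centre, .leaf 0, .leaf 1, .leaf 2, .leaf 3, .leaf 4]

theorem graphZ_connected : graphZ.Connected := by
  have step {v w : Fin 9} (hv : graphZ.Reachable 4 v) (h : graphZ.Adj v w) :
      graphZ.Reachable 4 w := hv.trans h.reachable
  have h3 : graphZ.Reachable 4 3 := step .rfl (by decide)
  have h5 : graphZ.Reachable 4 5 := step .rfl (by decide)
  have h8 : graphZ.Reachable 4 8 := step .rfl (by decide)
  have h2 : graphZ.Reachable 4 2 := step h3 (by decide)
  have h6 : graphZ.Reachable 4 6 := step h5 (by decide)
  have h1 : graphZ.Reachable 4 1 := step h2 (by decide)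
  have h7 : graphZ.Reachable 4 7 := step h6 (by decide)
  have h0 : graphZ.Reachable 4 0 := step h1 (by decide)
  refine (SimpleGraph.connected_iff_exists_forall_reachable _).2 ⟨4, fun v => ?_⟩
  fin_cases v <;> first | exact .rfl | assumption

/-- The list consists of the closed neighbourhoods in `Z_0`, as masks in the order `verticesX`;
`x` has number `10`. -/
theorem gameDominationNumber_graphX (k : ℕ) : gameDominationNumber (graphX k) = 2 * k + 6 := by
  rw [graphX, ← attachDel_false]
  exact gameDominationNumber_attachDel (x := (10 : Fin 16))
    (N := [131, 71, 46, 796, 1848, 884, 226, 193, 824, 2872, 64528, 3584, 5120, 9216, 17408, 33792])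
    (ι := verticesX) (by decide +kernel) ⟨by decide +kernel, by decide +kernel⟩ rfl
    (by decide +kernel) (by decide +kernel)

theorem gameDominationNumber_graphX_deleteEdges (k : ℕ) :
    gameDominationNumber ((graphX k).deleteEdges {specialEdge (Fin 9) k}) = 2 * k + 4 := by
  rw [graphX, ← attachDel_true]
  exact gameDominationNumber_attachDel (x := (10 : Fin 16))
    (N := [131, 71, 46, 796, 1848, 884, 226, 193, 824, 824, 64528, 3072, 5120, 9216, 17408, 33792])
    (ι := verticesX) (by decide +kernel) ⟨by decide +kernel, by decide +kernel⟩ rfl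
    (by decide +kernel) (by decide +kernel)

/-- The list consists of the closed neighbourhoods in `(C_6)_0`, as masks in the order `verticesQ`;
`x` has number `7`. -/
theorem gameDominationNumber_graphQ (k : ℕ) : gameDominationNumber (graphQ k) = 2 * k + 5 := by
  rw [graphQ, ← attachDel_false]
  exact gameDominationNumber_attachDel (x := (7 : Fin 13))
    (N := [227, 71, 14, 28, 56, 113, 355, 8065, 448, 640, 1152, 2176, 4224])
    (ι := verticesQ) (by decide +kernel) ⟨by decide +kernel, by decide +kernel⟩ rfl
    (by decide +kernel) (by decide +kernel)

theorem gameDominationNumber_graphQ_deleteEdges (k : ℕ) :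
    gameDominationNumber ((graphQ k).deleteEdges {specialEdge (Fin 6) k}) = 2 * k + 3 := by
  rw [graphQ, ← attachDel_true]
  exact gameDominationNumber_attachDel (x := (7 : Fin 13))
    (N := [227, 71, 14, 28, 56, 113, 99, 8065, 384, 640, 1152, 2176, 4224])
    (ι := verticesQ) (by decide +kernel) ⟨by decide +kernel, by decide +kernel⟩ rfl
    (by decide +kernel) (by decide +kernel)

end DominationGame

open DominationGame in
theorem mainTheorem4 :
    -- every value `ℓ ≥ 5` is realized by a connected graph
    (∀ ℓ : ℕ, 5 ≤ ℓ →
      ∃ (V : Type) (_ : Fintype V) (G : SimpleGraph V) (e : Sym2 V),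
        G.Connected ∧ e ∈ G.edgeSet ∧
        gameDominationNumber G = ℓ ∧ gameDominationNumber (G.deleteEdges {e}) = ℓ - 2) ∧
    -- the graphs `X_k` realize the even values
    (∀ k : ℕ,
      (graphX k).Connected ∧ specialEdge (Fin 9) k ∈ (graphX k).edgeSet ∧
      gameDominationNumber (graphX k) = 2 * k + 6 ∧
      gameDominationNumber ((graphX k).deleteEdges {specialEdge (Fin 9) k}) = 2 * k + 4) ∧
    -- the graphs `Q_k` realize the odd values
    (∀ k : ℕ,
      (graphQ k).Connected ∧ specialEdge (Fin 6) k ∈ (graphQ k).edgeSet ∧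
      gameDominationNumber (graphQ k) = 2 * k + 5 ∧
      gameDominationNumber ((graphQ k).deleteEdges {specialEdge (Fin 6) k}) = 2 * k + 3) ∧
    -- no graph, connected or not, realizes a value `ℓ ≤ 4`
    (∀ (V : Type*) [Fintype V] (G : SimpleGraph V) (e : Sym2 V), e ∈ G.edgeSet →
      gameDominationNumber G ≤ 4 →
      gameDominationNumber (G.deleteEdges {e}) + 2 ≠ gameDominationNumber G) := by
  have hX (k : ℕ) : (graphX k).Connected ∧ specialEdge (Fin 9) k ∈ (graphX k).edgeSet ∧
      gameDominationNumber (graphX k) = 2 * k + 6 ∧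
      gameDominationNumber ((graphX k).deleteEdges {specialEdge (Fin 9) k}) = 2 * k + 4 :=
    ⟨attach_connected graphZ_connected, specialEdge_mem_edgeSet, gameDominationNumber_graphX k,
      gameDominationNumber_graphX_deleteEdges k⟩
  have hQ (k : ℕ) : (graphQ k).Connected ∧ specialEdge (Fin 6) k ∈ (graphQ k).edgeSet ∧
      gameDominationNumber (graphQ k) = 2 * k + 5 ∧
      gameDominationNumber ((graphQ k).deleteEdges {specialEdge (Fin 6) k}) = 2 * k + 3 :=
    ⟨attach_connected SimpleGraph.cycleGraph_connected, specialEdge_mem_edgeSet,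
      gameDominationNumber_graphQ k, gameDominationNumber_graphQ_deleteEdges k⟩
  refine ⟨fun ℓ hℓ => ?_, hX, hQ, fun V _ G e _ hG =>
    gameDominationNumber_add_two_ne (G.deleteEdges_le {e}) hG⟩
  rcases Nat.even_or_odd' ℓ with ⟨n, rfl | rfl⟩
  · obtain ⟨hc, he, hG, hGe⟩ := hX (n - 3)
    exact ⟨_, inferInstance, _, _, hc, he, by omega, by omega⟩
  · obtain ⟨hc, he, hG, hGe⟩ := hQ (n - 2)
    exact ⟨_, inferInstance, _, _, hc, he, by omega, by omega⟩
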